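/- Let $S$ be a finite meet semilattice with $n$ elements. A congruence of $S$ is an equivalence relation $\Theta$ on $S$ such that $(a,b),(c,d)\in\Theta$ implies $(a\wedge c,\,b\wedge d)\in\Theta$. If $S$ has at least $25\cdot 2^{n-6}$ congruences, then $S$ is planar, that is, $S$ has a Hasse diagram in the plane (distinct points for distinct elements; for every covering pair $a\prec b$ a straight line segment from $a$ up to $b$ that passes through no other vertex) in which two distinct edges can intersect only at their common endpoints. (Here $2^{n-6}$ is a rational number, not necessarily an integer, when $n<6$.) -/

import Mathlib

/-- A congruence of a meet semilattice `S`: an equivalence relation compatible with `⊓`. -/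
structure MeetCongruence (S : Type*) [SemilatticeInf S] extends Setoid S where
  inf' : ∀ {a b c d : S}, toSetoid a b → toSetoid c d → toSetoid (a ⊓ c) (b ⊓ d)

/-- A Hasse diagram of a poset `P`: the elements of `P` are drawn as distinct points of the plane,
and each covering pair `a ⋖ b` is drawn as the straight line segment (the edge) from `a` up to `b`,
which is not horizontal or descending and passes through no vertex other than `a` and `b`. -/
structure HasseDiagram (P : Type*) [PartialOrder P] where
  pos : P → ℝ × ℝ
  pos_injective : Function.Injective pos
  height_lt : ∀ {a b : P}, a ⋖ b → (pos a).2 < (pos b).2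
  eq_of_mem_edge : ∀ {a b c : P}, a ⋖ b → pos c ∈ segment ℝ (pos a) (pos b) → c = a ∨ c = b

/-- A Hasse diagram is planar if any common point of two distinct edges is an endpoint of both. -/
def HasseDiagram.IsPlanar {P : Type*} [PartialOrder P] (D : HasseDiagram P) : Prop :=
  ∀ a b c d : P, a ⋖ b → c ⋖ d → (a, b) ≠ (c, d) →
    ∀ x : ℝ × ℝ, x ∈ segment ℝ (D.pos a) (D.pos b) → x ∈ segment ℝ (D.pos c) (D.pos d) →
      (x = D.pos a ∨ x = D.pos b) ∧ (x = D.pos c ∨ x = D.pos d)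

/-- A poset is planar if it has a planar Hasse diagram. -/
def IsPlanarPoset (P : Type*) [PartialOrder P] : Prop :=
  ∃ D : HasseDiagram P, D.IsPlanar

/-!
A congruence of a finite meet semilattice `S` is determined by the least elements of its blocks, and
the set of these contains the bottom of `S` and is closed under all existing joins. So the
number of congruences is at most the number of sets of nonzero elements closed under existing joins,
and the hypothesis says that at least `25 / 32` of all the sets of nonzero elements are closed.

Call two elements in conflict if they are incomparable but have an upper bound; each conflict excludes
the sets containing the pair but not its join. Counting on at most seven elements at a time
(`HasManyCongruences.false_of_joins`), the bound `25 / 32` forbids two disjoint conflicts and triangles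
of conflicts. Hence all conflicts contain one element `a` (`HasManyCongruences.exists_center`), and
the elements in conflict with `a` either form a chain or are two elements without a common upper
bound (`HasManyCongruences.eq_of_conflict`).

Such a semilattice has order dimension at most two (`HasManyCongruences.embedsInGrid`): above an element
that occurs in no conflict the order can be split off as an autonomous part
(`EmbedsInGrid.of_above`), and when no such reduction is left the coordinates are written down
(`EmbedsInGrid.of_chain`, `EmbedsInGrid.of_two`). Finally, if `f` and `g` embed the order of `S` into a
product of two chains, then the drawing with coordinates `(f, f + g)` is planar: two edges `a ⋖ b`
and `c ⋖ d` with a common point satisfy `a, c ≤ b ⊓ d ≤ b, d`, so they share a vertex, and edges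
with a common vertex have no other common point (`EmbedsInGrid.isPlanarPoset`).
-/

/-! ### Congruences as sets of block minima -/

open Classical in
theorem exists_isLeast_of_infClosed {S : Type*} [SemilatticeInf S] [Finite S] {s : Set S}
    (hs : InfClosed s) (hne : s.Nonempty) : ∃ m, IsLeast s m := by
  have := Fintype.ofFinite S
  have hne' : s.toFinset.Nonempty := by simpa using hne
  refine ⟨s.toFinset.inf' hne' id, hs.finsetInf'_mem hne' (by simp), fun x hx => ?_⟩
  exact Finset.inf'_le id (by simpa using hx)

theorem exists_isBot {S : Type*} [SemilatticeInf S] [Finite S] [Nonempty S] :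
    ∃ z : S, IsBot z := by
  obtain ⟨z, hz⟩ := exists_isLeast_of_infClosed (s := (Set.univ : Set S))
    infClosed_univ Set.univ_nonempty
  exact ⟨z, fun x => hz.2 (Set.mem_univ x)⟩

theorem exists_isLUB_pair {S : Type*} [SemilatticeInf S] [Finite S] {x y u : S}
    (hx : x ≤ u) (hy : y ≤ u) : ∃ c, IsLUB {x, y} c :=
  exists_isLeast_of_infClosed (s := upperBounds {x, y})
    (fun p hp q hq r hr => le_inf (hp hr) (hq hr)) ⟨u, by simp [hx, hy]⟩

namespace MeetCongruence

variable {S : Type*} [SemilatticeInf S]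

/-- The set of the least elements of the blocks of a congruence. -/
def blockMinima (Θ : MeetCongruence S) : Set S :=
  {x | ∀ y, Θ.toSetoid x y → x ≤ y}

theorem isBot_mem_blockMinima (Θ : MeetCongruence S) {z : S} (hz : IsBot z) :
    z ∈ Θ.blockMinima :=
  fun y _ => hz y

theorem le_of_mem_blockMinima (Θ : MeetCongruence S) {x y z : S} (hz : z ∈ Θ.blockMinima)
    (h : Θ.toSetoid x y) (hzx : z ≤ x) : z ≤ y := by
  have h1 := Θ.inf' h (Θ.toSetoid.refl z)
  rw [inf_eq_right.2 hzx] at h1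
  exact (hz _ h1).trans inf_le_left

/-- The block minima are closed under those joins that exist. -/
theorem isLUB_mem_blockMinima (Θ : MeetCongruence S) {x y z : S} (hx : x ∈ Θ.blockMinima)
    (hy : y ∈ Θ.blockMinima) (hz : IsLUB {x, y} z) : z ∈ Θ.blockMinima := by
  intro w hw
  refine hz.2 ?_
  rintro p (rfl | rfl)
  · exact Θ.le_of_mem_blockMinima hx hw (hz.1 (by simp))
  · exact Θ.le_of_mem_blockMinima hy hw (hz.1 (by simp))

theorem exists_mem_blockMinima [Finite S] (Θ : MeetCongruence S) (x : S) :
    ∃ m ∈ Θ.blockMinima, Θ.toSetoid x m ∧ m ≤ x := by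
  obtain ⟨m, hm, hm'⟩ := exists_isLeast_of_infClosed (s := {y | Θ.toSetoid x y})
    (fun p hp q hq => by
      have := Θ.inf' hp hq
      rwa [inf_idem] at this) ⟨x, Θ.toSetoid.refl x⟩
  exact ⟨m, fun y hy => hm' (Θ.toSetoid.trans hm hy), hm, hm' (Θ.toSetoid.refl x)⟩

/-- Two elements are congruent if and only if the same block minima lie below them. -/
theorem rel_iff_blockMinima [Finite S] (Θ : MeetCongruence S) (x y : S) :
    Θ.toSetoid x y ↔ ∀ z ∈ Θ.blockMinima, z ≤ x ↔ z ≤ y := by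
  refine ⟨fun h z hz => ⟨Θ.le_of_mem_blockMinima hz h,
    Θ.le_of_mem_blockMinima hz (Θ.toSetoid.symm h)⟩, fun h => ?_⟩
  obtain ⟨p, hp, hxp, hpx⟩ := Θ.exists_mem_blockMinima x
  obtain ⟨q, hq, hyq, hqy⟩ := Θ.exists_mem_blockMinima y
  have hpq : p = q := le_antisymm (Θ.le_of_mem_blockMinima hp hyq ((h p hp).1 hpx))
    (Θ.le_of_mem_blockMinima hq hxp ((h q hq).2 hqy))
  subst hpq
  exact Θ.toSetoid.trans hxp (Θ.toSetoid.symm hyq)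

theorem blockMinima_injective [Finite S] :
    Function.Injective (blockMinima : MeetCongruence S → Set S) := by
  intro Θ Ψ h
  have : Θ.toSetoid = Ψ.toSetoid := by
    ext x y
    rw [rel_iff_blockMinima, rel_iff_blockMinima, h]
  cases Θ
  cases Ψ
  congr

end MeetCongruence

/-! ### Counting congruences -/

/-- The number of subsets of `Fin m`, given by characteristic functions, that are closed under
all the rules "if `i` and `j` are present, then so is `k`" with `(i, j, k)` in the list `L`. -/
def closedCount {m : ℕ} (L : List (Fin m × Fin m × Fin m)) : ℕ :=
  Fintype.card {v : Fin m → Bool // ∀ t ∈ L, v t.1 = true → v t.2.1 = true → v t.2.2 = true}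

/-- A family of `m` distinct nonzero elements with joins prescribed by `L` bounds the proportion of
congruences among the `2 ^ (n - 1)` sets of nonzero elements by `closedCount L / 2 ^ m`. -/
theorem card_meetCongruence_mul_le {S : Type*} [SemilatticeInf S] [Finite S] {m : ℕ}
    (e : Fin m → S) (he : Function.Injective e) {z : S} (hz : IsBot z) (hze : ∀ i, e i ≠ z)
    (L : List (Fin m × Fin m × Fin m)) (hL : ∀ t ∈ L, IsLUB {e t.1, e t.2.1} (e t.2.2)) :
    Nat.card (MeetCongruence S) * 2 ^ (m + 1) ≤ closedCount L * 2 ^ Nat.card S := by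
  classical
  have := Fintype.ofFinite S
  let R : Set S := insert z (Set.range e)
  let F : MeetCongruence S →
      {v : Fin m → Bool // ∀ t ∈ L, v t.1 = true → v t.2.1 = true → v t.2.2 = true} ×
        Set (Rᶜ : Set S) := fun Θ =>
    (⟨fun i => decide (e i ∈ Θ.blockMinima), fun t ht h1 h2 => by
      simp only [decide_eq_true_eq] at h1 h2 ⊢
      exact Θ.isLUB_mem_blockMinima h1 h2 (hL t ht)⟩, {x | (x : S) ∈ Θ.blockMinima})
  have hF : Function.Injective F := by
    intro Θ Ψ h
    obtain ⟨h1, h2⟩ := Prod.ext_iff.1 h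
    apply MeetCongruence.blockMinima_injective
    ext x
    by_cases hx : x ∈ R
    · rcases hx with rfl | ⟨i, rfl⟩
      · simp only [MeetCongruence.isBot_mem_blockMinima _ hz]
      · have := congrFun (congrArg Subtype.val h1) i
        simpa [F] using this
    · have := Set.ext_iff.1 h2 ⟨x, hx⟩
      simpa [F] using this
  have hle := Nat.card_le_card_of_injective F hF
  rw [Nat.card_prod] at hle
  have hR : R.ncard = m + 1 := by
    have hzr : z ∉ Set.range e := by
      rintro ⟨i, hi⟩
      exact hze i hi
    rw [Set.ncard_insert_of_notMem hzr, ← Nat.card_coe_set_eq, Nat.card_range_of_injective he]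
    simp
  have hsum : (Rᶜ : Set S).ncard + (m + 1) = Nat.card S := by
    rw [← hR, add_comm]
    exact Set.ncard_add_ncard_compl R
  have hset : Nat.card (Set (Rᶜ : Set S)) = 2 ^ (Rᶜ : Set S).ncard := by
    rw [Nat.card_eq_fintype_card, Fintype.card_set, ← Nat.card_eq_fintype_card,
      Nat.card_coe_set_eq]
  have hcount : Nat.card {v : Fin m → Bool //
      ∀ t ∈ L, v t.1 = true → v t.2.1 = true → v t.2.2 = true} = closedCount L :=
    Nat.card_eq_fintype_card
  rw [hset, hcount] at hle
  calc _ ≤ _ := Nat.mul_le_mul_right (2 ^ (m + 1)) hle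
    _ = closedCount L * 2 ^ Nat.card S := by
      rw [← hsum, pow_add 2 (Rᶜ : Set S).ncard, ← mul_assoc]

/-- Two elements are in conflict if they are incomparable but have a common upper bound. In a finite
meet semilattice these are the pairs that have a join different from both of them. -/
def Conflict {S : Type*} [SemilatticeInf S] (x y : S) : Prop :=
  ¬ x ≤ y ∧ ¬ y ≤ x ∧ ∃ u, x ≤ u ∧ y ≤ u

/-- The semilattice has at least `25 / 32` of the largest conceivable number `2 ^ (n - 1)` of
congruences. -/
def HasManyCongruences (S : Type*) [SemilatticeInf S] : Prop :=
  25 * 2 ^ Nat.card S ≤ 64 * Nat.card (MeetCongruence S)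

/-! ### Conflicts -/

section Conflicts

variable {S : Type*} [SemilatticeInf S]

theorem Conflict.symm {x y : S} (h : Conflict x y) : Conflict y x :=
  ⟨h.2.1, h.1, h.2.2.imp fun _ hu => hu.symm⟩

/-- A configuration of joins with too few closed subsets does not occur. The nonzero elements are
listed without repetition in `e`. -/
theorem HasManyCongruences.false_of_joins [Finite S] (H : HasManyCongruences S) {m : ℕ}
    (e : Fin m → S) (he : (List.ofFn e).Nodup) (hmin : ∀ i, ∃ w, ¬ e i ≤ w)
    (L : List (Fin m × Fin m × Fin m)) (hL : ∀ t ∈ L, IsLUB {e t.1, e t.2.1} (e t.2.2))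
    (hcount : 32 * closedCount L < 25 * 2 ^ m) : False := by
  rcases isEmpty_or_nonempty S with hS | hS
  · have hm : m = 0 := by
      rcases m with - | m
      · rfl
      · exact hS.elim (e 0)
    have : L = [] := by
      subst hm
      exact List.eq_nil_iff_forall_not_mem.2 fun t _ => t.1.elim0
    subst hm this
    revert hcount
    decide
  obtain ⟨z, hz⟩ := exists_isBot (S := S)
  have h := card_meetCongruence_mul_le e (List.nodup_ofFn.1 he) hz
    (fun i hi => by
      obtain ⟨w, hw⟩ := hmin i
      exact hw (hi ▸ hz w)) L hL
  unfold HasManyCongruences at H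
  have hpos : 0 < 2 ^ Nat.card S := by positivity
  have h1 : 25 * 2 ^ m * 2 ^ Nat.card S ≤ 32 * closedCount L * 2 ^ Nat.card S := by
    have := Nat.mul_le_mul_right (2 ^ m) H
    rw [pow_succ] at h
    nlinarith
  exact absurd (Nat.le_of_mul_le_mul_right h1 hpos) (not_le.2 hcount)

theorem Conflict.exists_isLUB [Finite S] {x y : S} (h : Conflict x y) : ∃ c, IsLUB {x, y} c :=
  let ⟨_, _, _, hx, hy⟩ := h
  exists_isLUB_pair hx hy

end Conflicts

/-! ### The graph of conflicts -/

section ConflictGraph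

variable {S : Type*} [SemilatticeInf S] [Finite S]

/-- Two disjoint conflicts with the same join leave exactly the proportion `25 / 32`; a third conflict
between them, whatever its join, goes below this. -/
theorem HasManyCongruences.false_of_cross_conflict (H : HasManyCongruences S) {a b d e c : S}
    (hab : Conflict a b) (hde : Conflict d e) (had : Conflict a d) (hc : IsLUB {a, b} c)
    (hc' : IsLUB {d, e} c) (hdb : d ≠ b) (hea : e ≠ a) (heb : e ≠ b) : False := by
  obtain ⟨g, hg⟩ := had.exists_isLUB
  have ha : a ≤ c := hc.1 (by simp)
  have hb : b ≤ c := hc.1 (by simp)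
  have hd : d ≤ c := hc'.1 (by simp)
  have he : e ≤ c := hc'.1 (by simp)
  have hag : a ≤ g := hg.1 (by simp)
  have hdg : d ≤ g := hg.1 (by simp)
  obtain ⟨hab1, hab2, -⟩ := hab
  obtain ⟨hde1, hde2, -⟩ := hde
  obtain ⟨had1, had2, -⟩ := had
  by_cases hgc : g = c
  · subst hgc
    refine H.false_of_joins ![a, b, d, e, g] ?_ ?_ [(0, 1, 4), (2, 3, 4), (0, 2, 4)]
      (List.forall_mem_cons.2 ⟨hc, List.forall_mem_cons.2 ⟨hc', List.forall_mem_cons.2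
        ⟨hg, by simp⟩⟩⟩) (by decide +kernel)
    · simp [List.ofFn_succ]
      and_intros <;> grind
    · intro i
      fin_cases i
      exacts [⟨b, hab1⟩, ⟨a, hab2⟩, ⟨e, hde1⟩, ⟨d, hde2⟩, ⟨a, fun h => hab2 (hb.trans h)⟩]
  · refine H.false_of_joins ![a, b, d, e, c, g] ?_ ?_ [(0, 1, 4), (2, 3, 4), (0, 2, 5)]
      (List.forall_mem_cons.2 ⟨hc, List.forall_mem_cons.2 ⟨hc', List.forall_mem_cons.2
        ⟨hg, by simp⟩⟩⟩) (by decide +kernel)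
    · simp [List.ofFn_succ]
      and_intros <;> grind
    · intro i
      fin_cases i
      exacts [⟨b, hab1⟩, ⟨a, hab2⟩, ⟨e, hde1⟩, ⟨d, hde2⟩, ⟨a, fun h => hab2 (hb.trans h)⟩,
        ⟨a, fun h => had2 (hdg.trans h)⟩]

/-- The join of a conflict is not itself in conflict with anything. -/
theorem HasManyCongruences.false_of_join_conflict (H : HasManyCongruences S) {a b c e : S}
    (hab : Conflict a b) (hc : IsLUB {a, b} c) (hce : Conflict c e) : False := by
  obtain ⟨f, hf⟩ := hce.exists_isLUB
  have ha : a ≤ c := hc.1 (by simp)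
  have hb : b ≤ c := hc.1 (by simp)
  have hcf : c ≤ f := hf.1 (by simp)
  have hef : e ≤ f := hf.1 (by simp)
  obtain ⟨hab1, hab2, -⟩ := hab
  obtain ⟨hce1, hce2, -⟩ := hce
  refine H.false_of_joins ![a, b, c, e, f] ?_ ?_ [(0, 1, 2), (2, 3, 4)]
    (List.forall_mem_cons.2 ⟨hc, List.forall_mem_cons.2 ⟨hf, by simp⟩⟩) (by decide +kernel)
  · simp [List.ofFn_succ]
    and_intros <;> grind
  · intro i
    fin_cases i
    exacts [⟨b, hab1⟩, ⟨a, hab2⟩, ⟨e, hce1⟩, ⟨c, hce2⟩, ⟨e, fun h => hce1 (hcf.trans h)⟩]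

theorem HasManyCongruences.false_of_disjoint_conflicts (H : HasManyCongruences S) {a b d e : S}
    (hab : Conflict a b) (hde : Conflict d e) (hda : d ≠ a) (hdb : d ≠ b) (hea : e ≠ a)
    (heb : e ≠ b) : False := by
  obtain ⟨c, hc⟩ := hab.exists_isLUB
  obtain ⟨f, hf⟩ := hde.exists_isLUB
  have hba : IsLUB {b, a} c := by rwa [Set.pair_comm]
  have hed : IsLUB {e, d} f := by rwa [Set.pair_comm]
  have ha : a ≤ c := hc.1 (by simp)
  have hb : b ≤ c := hc.1 (by simp)
  have hd : d ≤ f := hf.1 (by simp)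
  have he : e ≤ f := hf.1 (by simp)
  rcases eq_or_ne c f with rfl | hcf
  -- Below a common join, the two pairs cannot be completely comparable to each other.
  · have key : ∀ x y, x ≤ c → y ≤ c → ¬ Conflict x y → x ≤ y ∨ y ≤ x := by
      intro x y hx hy h
      by_contra h'
      push Not at h'
      exact h ⟨h'.1, h'.2, c, hx, hy⟩
    have h1 := key a d ha hd fun h =>
      H.false_of_cross_conflict hab hde h hc hf hdb hea heb
    have h2 := key a e ha he fun h =>
      H.false_of_cross_conflict hab hde.symm h hc hed heb hda hdb
    have h3 := key b d hb hd fun h =>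
      H.false_of_cross_conflict hab.symm hde h hba hf hda heb hea
    have h4 := key b e hb he fun h =>
      H.false_of_cross_conflict hab.symm hde.symm h hba hed hea hdb hda
    have hmin1 : ∀ u, a ≤ u → b ≤ u → c ≤ u := fun u h h' => hc.2 (by simp [h, h'])
    have hmin2 : ∀ u, d ≤ u → e ≤ u → c ≤ u := fun u h h' => hf.2 (by simp [h, h'])
    obtain ⟨hab1, hab2, -⟩ := hab
    obtain ⟨hde1, hde2, -⟩ := hde
    grind
  rcases eq_or_ne c d with rfl | hcd
  · exact H.false_of_join_conflict hab hc hde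
  rcases eq_or_ne c e with rfl | hce
  · exact H.false_of_join_conflict hab hc hde.symm
  rcases eq_or_ne f a with rfl | hfa
  · exact H.false_of_join_conflict hde hf hab
  rcases eq_or_ne f b with rfl | hfb
  · exact H.false_of_join_conflict hde hf hab.symm
  obtain ⟨hab1, hab2, -⟩ := hab
  obtain ⟨hde1, hde2, -⟩ := hde
  refine H.false_of_joins ![a, b, d, e, c, f] ?_ ?_ [(0, 1, 4), (2, 3, 5)]
    (List.forall_mem_cons.2 ⟨hc, List.forall_mem_cons.2 ⟨hf, by simp⟩⟩) (by decide +kernel)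
  · simp [List.ofFn_succ]
    and_intros <;> grind
  · intro i
    fin_cases i
    exacts [⟨b, hab1⟩, ⟨a, hab2⟩, ⟨e, hde1⟩, ⟨d, hde2⟩, ⟨a, fun h => hab2 (hb.trans h)⟩,
      ⟨d, fun h => hde2 (he.trans h)⟩]

/-- A triangle of conflicts in which two of the three joins coincide is impossible. -/
theorem HasManyCongruences.false_of_triangle_of_eq (H : HasManyCongruences S) {a b d p r : S}
    (hab : Conflict a b) (had : Conflict a d) (hbd : Conflict b d) (hp : IsLUB {a, b} p)
    (hq : IsLUB {a, d} p) (hr : IsLUB {b, d} r) : False := by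
  have ha : a ≤ p := hp.1 (by simp)
  have hb : b ≤ p := hp.1 (by simp)
  have hd : d ≤ p := hq.1 (by simp)
  have hbr : b ≤ r := hr.1 (by simp)
  have hdr : d ≤ r := hr.1 (by simp)
  obtain ⟨hab1, hab2, -⟩ := hab
  obtain ⟨had1, had2, -⟩ := had
  obtain ⟨hbd1, hbd2, -⟩ := hbd
  rcases eq_or_ne r p with rfl | hrp
  · refine H.false_of_joins ![a, b, d, r] ?_ ?_ [(0, 1, 3), (0, 2, 3), (1, 2, 3)]
      (List.forall_mem_cons.2 ⟨hp, List.forall_mem_cons.2 ⟨hq, List.forall_mem_cons.2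
        ⟨hr, by simp⟩⟩⟩) (by decide +kernel)
    · simp [List.ofFn_succ]
      and_intros <;> grind
    · intro i
      fin_cases i
      exacts [⟨b, hab1⟩, ⟨a, hab2⟩, ⟨a, had2⟩, ⟨a, fun h => hab2 (hb.trans h)⟩]
  · refine H.false_of_joins ![a, b, d, p, r] ?_ ?_ [(0, 1, 3), (0, 2, 3), (1, 2, 4)]
      (List.forall_mem_cons.2 ⟨hp, List.forall_mem_cons.2 ⟨hq, List.forall_mem_cons.2
        ⟨hr, by simp⟩⟩⟩) (by decide +kernel)
    · simp [List.ofFn_succ]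
      and_intros <;> grind
    · intro i
      fin_cases i
      exacts [⟨b, hab1⟩, ⟨a, hab2⟩, ⟨a, had2⟩, ⟨a, fun h => hab2 (hb.trans h)⟩,
        ⟨b, fun h => hbd2 (hdr.trans h)⟩]

theorem HasManyCongruences.false_of_triangle (H : HasManyCongruences S) {a b d : S}
    (hab : Conflict a b) (had : Conflict a d) (hbd : Conflict b d) : False := by
  obtain ⟨p, hp⟩ := hab.exists_isLUB
  obtain ⟨q, hq⟩ := had.exists_isLUB
  obtain ⟨r, hr⟩ := hbd.exists_isLUB
  rcases eq_or_ne p q with rfl | hpq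
  · exact H.false_of_triangle_of_eq hab had hbd hp hq hr
  rcases eq_or_ne p r with rfl | hpr
  · exact H.false_of_triangle_of_eq hab.symm hbd had (by rwa [Set.pair_comm]) hr hq
  rcases eq_or_ne q r with rfl | hqr
  · exact H.false_of_triangle_of_eq had.symm hbd.symm hab (by rwa [Set.pair_comm])
      (by rwa [Set.pair_comm]) hp
  have ha : a ≤ p := hp.1 (by simp)
  have hb : b ≤ p := hp.1 (by simp)
  have haq : a ≤ q := hq.1 (by simp)
  have hdq : d ≤ q := hq.1 (by simp)
  have hbr : b ≤ r := hr.1 (by simp)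
  have hdr : d ≤ r := hr.1 (by simp)
  obtain ⟨hab1, hab2, -⟩ := hab
  obtain ⟨had1, had2, -⟩ := had
  obtain ⟨hbd1, hbd2, -⟩ := hbd
  refine H.false_of_joins ![a, b, d, p, q, r] ?_ ?_ [(0, 1, 3), (0, 2, 4), (1, 2, 5)]
    (List.forall_mem_cons.2 ⟨hp, List.forall_mem_cons.2 ⟨hq, List.forall_mem_cons.2
      ⟨hr, by simp⟩⟩⟩) (by decide +kernel)
  · simp [List.ofFn_succ]
    and_intros <;> grind
  · intro i
    fin_cases i
    exacts [⟨b, hab1⟩, ⟨a, hab2⟩, ⟨a, had2⟩, ⟨a, fun h => hab2 (hb.trans h)⟩,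
      ⟨a, fun h => had2 (hdq.trans h)⟩, ⟨b, fun h => hbd2 (hdr.trans h)⟩]

/-- Any two conflicts share an element and conflicts form no triangle, so that the graph of
conflicts is a star. -/
theorem HasManyCongruences.exists_center [Nonempty S] (H : HasManyCongruences S) :
    ∃ a : S, ∀ x y, Conflict x y → x = a ∨ y = a := by
  by_cases hne : ∃ a b : S, Conflict a b
  · obtain ⟨a, b, hab⟩ := hne
    by_contra! hcon
    obtain ⟨x, y, hxy, hxa, hya⟩ := hcon a
    obtain ⟨u, v, huv, hub, hvb⟩ := hcon b
    have key : ∀ d, Conflict b d → d ≠ a → False := by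
      intro d hbd hda
      have hdb : d ≠ b := fun h => hbd.1 h.ge
      have hba : b ≠ a := fun h => hab.1 h.ge
      have h1 : u = a ∨ v = a := by
        by_contra! h
        exact H.false_of_disjoint_conflicts hab huv h.1 hub h.2 hvb
      have h2 : u = d ∨ v = d := by
        by_contra! h
        exact H.false_of_disjoint_conflicts hbd huv hub h.1 hvb h.2
      have had : Conflict a d := by
        rcases h1 with rfl | rfl <;> rcases h2 with rfl | rfl
        exacts [absurd rfl hda, huv, huv.symm, absurd rfl hda]
      exact H.false_of_triangle hab had hbd
    by_cases hxb : x = b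
    · subst hxb
      exact key y hxy hya
    by_cases hyb : y = b
    · subst hyb
      exact key x hxy.symm hxa
    exact H.false_of_disjoint_conflicts hab hxy hxa hxb hya hyb
  · push Not at hne
    exact ⟨Classical.arbitrary S, fun x y h => absurd h (hne x y)⟩

/-- If the center `a` is in conflict with `b` and `d`, and these have no common upper bound, then
it is in conflict with no third element. -/
theorem HasManyCongruences.eq_of_conflict (H : HasManyCongruences S) {a b d x : S}
    (hab : Conflict a b) (had : Conflict a d) (hbd : ∀ u, b ≤ u → ¬ d ≤ u)
    (hax : Conflict a x) : x = b ∨ x = d := by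
  by_contra! hx
  obtain ⟨hxb, hxd⟩ := hx
  -- The join of `a` with a third partner differs from the joins with the first two.
  have key : ∀ p q : S, Conflict a p → Conflict a q → (∀ u, p ≤ u → ¬ q ≤ u) → x ≠ p → x ≠ q →
      ∀ c f, IsLUB {a, p} c → IsLUB {a, q} f → ¬ IsLUB {a, x} c := by
    intro p q hap haq hpq hxp hxq c f hc hf hxc
    have ha : a ≤ c := hc.1 (by simp)
    have hp : p ≤ c := hc.1 (by simp)
    have hx : x ≤ c := hxc.1 (by simp)
    have haf : a ≤ f := hf.1 (by simp)
    have hqf : q ≤ f := hf.1 (by simp)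
    obtain ⟨hap1, hap2, -⟩ := hap
    obtain ⟨haq1, haq2, -⟩ := haq
    obtain ⟨hax1, hax2, -⟩ := hax
    have hpq' := hpq p le_rfl
    have hcq := hpq c hp
    refine H.false_of_joins ![a, p, q, x, c, f] ?_ ?_ [(0, 1, 4), (0, 2, 5), (0, 3, 4)]
      (List.forall_mem_cons.2 ⟨hc, List.forall_mem_cons.2 ⟨hf, List.forall_mem_cons.2
        ⟨hxc, by simp⟩⟩⟩) (by decide +kernel)
    · simp [List.ofFn_succ]
      and_intros <;> grind
    · intro i
      fin_cases i
      exacts [⟨p, hap1⟩, ⟨a, hap2⟩, ⟨a, haq2⟩, ⟨a, hax2⟩, ⟨a, fun h => hap2 (hp.trans h)⟩,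
        ⟨a, fun h => haq2 (hqf.trans h)⟩]
  obtain ⟨c, hc⟩ := hab.exists_isLUB
  obtain ⟨f, hf⟩ := had.exists_isLUB
  obtain ⟨g, hg⟩ := hax.exists_isLUB
  have hgc : g ≠ c := by
    rintro rfl
    exact key b d hab had hbd hxb hxd g f hc hf hg
  have hgf : g ≠ f := by
    rintro rfl
    exact key d b had hab (fun u h h' => hbd u h' h) hxd hxb g c hf hc hg
  have hac : a ≤ c := hc.1 (by simp)
  have hbc : b ≤ c := hc.1 (by simp)
  have haf : a ≤ f := hf.1 (by simp)
  have hdf : d ≤ f := hf.1 (by simp)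
  have hag : a ≤ g := hg.1 (by simp)
  have hxg : x ≤ g := hg.1 (by simp)
  obtain ⟨hab1, hab2, -⟩ := hab
  obtain ⟨had1, had2, -⟩ := had
  obtain ⟨hax1, hax2, -⟩ := hax
  have hbd' := hbd b le_rfl
  have hcd := hbd c hbc
  clear key
  refine H.false_of_joins ![a, b, d, x, c, f, g] ?_ ?_ [(0, 1, 4), (0, 2, 5), (0, 3, 6)]
    (List.forall_mem_cons.2 ⟨hc, List.forall_mem_cons.2 ⟨hf, List.forall_mem_cons.2
      ⟨hg, by simp⟩⟩⟩) (by decide +kernel)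
  · simp [List.ofFn_succ]
    and_intros <;> grind
  · intro i
    fin_cases i
    exacts [⟨b, hab1⟩, ⟨a, hab2⟩, ⟨a, had2⟩, ⟨a, hax2⟩, ⟨a, fun h => hab2 (hbc.trans h)⟩,
      ⟨a, fun h => had2 (hdf.trans h)⟩, ⟨a, fun h => hax2 (hxg.trans h)⟩]

end ConflictGraph

/-! ### Embeddings into a product of two chains -/

/-- The order of `A` is the restriction of the product order of `ℕ × ℕ` along some map, that is,
`A` has order dimension at most two. -/
def EmbedsInGrid {P : Type*} [PartialOrder P] (A : Set P) : Prop :=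
  ∃ f g : P → ℕ, ∀ x ∈ A, ∀ y ∈ A, x ≤ y ↔ f x ≤ f y ∧ g x ≤ g y

section EmbedsInGrid

variable {P : Type*}

/-- A linear preorder on a finite type is given by a rank function. -/
theorem exists_rank [Finite P] {α : Type*} [LinearOrder α] (f : P → α) :
    ∃ r : P → ℕ, ∀ x y, r x ≤ r y ↔ f x ≤ f y := by
  refine ⟨fun x => {z | f z < f x}.ncard, fun x y => ⟨fun h => ?_, fun h => ?_⟩⟩
  · by_contra! hlt
    refine absurd h (not_le.2 (Set.ncard_lt_ncard ?_))
    exact ⟨fun z hz => lt_trans hz hlt, fun hss => lt_irrefl (f y) (hss hlt)⟩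
  · exact Set.ncard_le_ncard fun z hz => lt_of_lt_of_le hz h

variable [PartialOrder P] [Finite P]

theorem EmbedsInGrid.of_linearOrder {A : Set P} {α β : Type*} [LinearOrder α] [LinearOrder β]
    (f : P → α) (g : P → β) (h : ∀ x ∈ A, ∀ y ∈ A, x ≤ y ↔ f x ≤ f y ∧ g x ≤ g y) :
    EmbedsInGrid A := by
  obtain ⟨r, hr⟩ := exists_rank f
  obtain ⟨s, hs⟩ := exists_rank g
  exact ⟨r, s, fun x hx y hy => by rw [hr, hs, h x hx y hy]⟩

/-- It is enough to represent the strict order by two strict inequalities: a tie in one coordinate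
is broken against the order of the other coordinate. -/
theorem EmbedsInGrid.of_lt {A : Set P} (k l : P → ℕ)
    (h : ∀ x ∈ A, ∀ y ∈ A, x < y ↔ k x < k y ∧ l x < l y) : EmbedsInGrid A := by
  obtain ⟨n, ⟨r⟩⟩ := Finite.exists_equiv_fin P
  refine EmbedsInGrid.of_linearOrder
    (fun x => toLex ((k x : ℤ), toLex (-(l x : ℤ), ((r x : ℕ) : ℤ))))
    (fun x => toLex ((l x : ℤ), toLex (-(k x : ℤ), -((r x : ℕ) : ℤ)))) fun x hx y hy => ?_
  have hxy := h x hx y hy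
  have hr : x = y ↔ (r x : ℕ) = r y := by rw [Fin.val_inj, r.injective.eq_iff]
  have hkl : (r x : ℕ) = r y → k x = k y ∧ l x = l y := fun h => by simp [hr.2 h]
  rw [le_iff_eq_or_lt, hxy, hr]
  simp only [Prod.Lex.toLex_le_toLex]
  omega

/-- If `y` is comparable to every element lying below an element above `y`, then the elements
above `y` can be inserted immediately after `y` in both linear orders. -/
theorem EmbedsInGrid.of_above {A : Set P} {y : P} (hy : y ∈ A)
    (hcomp : ∀ x ∈ A, ∀ m ∈ A, y < m → x ≤ m → x ≤ y ∨ y < x)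
    (h₁ : EmbedsInGrid {m ∈ A | y < m}) (h₂ : EmbedsInGrid {x ∈ A | ¬ y < x}) :
    EmbedsInGrid A := by
  classical
  obtain ⟨f₁, g₁, h₁⟩ := h₁
  obtain ⟨f, g, h₂⟩ := h₂
  refine EmbedsInGrid.of_linearOrder
    (fun x => if y < x then toLex (f y, f₁ x + 1) else toLex (f x, 0))
    (fun x => if y < x then toLex (g y, g₁ x + 1) else toLex (g x, 0)) fun u hu v hv => ?_
  have hyy : ¬ y < y := lt_irrefl y
  by_cases hyu : y < u <;> by_cases hyv : y < v <;>
    simp only [hyu, hyv, if_true, if_false, Prod.Lex.toLex_le_toLex, lt_self_iff_false, true_and,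
      false_or]
  · rw [h₁ u ⟨hu, hyu⟩ v ⟨hv, hyv⟩]
    omega
  · refine ⟨fun h => absurd (hyu.trans_le h) hyv, fun h => ?_⟩
    have hle : y ≤ v := (h₂ y ⟨hy, hyy⟩ v ⟨hv, hyv⟩).2 (by omega)
    have hne : y ≠ v := by
      rintro rfl
      omega
    exact absurd (lt_of_le_of_ne hle hne) hyv
  · have huy : u ≤ v ↔ u ≤ y :=
      ⟨fun h => (hcomp u hu v hv hyv h).resolve_right hyu, fun h => h.trans hyv.le⟩
    rw [huy, h₂ u ⟨hu, hyu⟩ y ⟨hy, hyy⟩]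
    omega
  · rw [h₂ u ⟨hu, hyu⟩ v ⟨hv, hyv⟩]
    omega

end EmbedsInGrid

/-! ### Semilattices with many congruences embed into the grid -/

section Embedding

variable {S : Type*} [SemilatticeInf S] [Finite S]

/-- The case where the partners of the center `a` form a chain. The elements of
`A` that occur in no conflict are maximal in `A`, so their position in the order is given by the
elements in conflict below them. The chain lies on the diagonal, `a` lies to the right of and below the whole
chain, and each maximal element is pushed to the right boundary if it is above `a` and to the upper
boundary otherwise. -/
theorem EmbedsInGrid.of_chain {A : Set S} {a : S} (hstar : ∀ x y, Conflict x y → x = a ∨ y = a)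
    (hchain : ∀ b d, Conflict a b → Conflict a d → b ≤ d ∨ d ≤ b)
    (hA : ∀ x ∈ A, (∃ y, Conflict x y) ∨ ∀ y ∈ A, ¬ x < y) : EmbedsInGrid A := by
  classical
  -- `i x` is the number of elements of the chain below `x`.
  let i : S → ℕ := fun x => {b | Conflict a b ∧ b ≤ x}.ncard
  let n : ℕ := {b | Conflict a b}.ncard
  have hi : ∀ x, i x ≤ n := fun x => Set.ncard_le_ncard fun b hb => hb.1
  have hle : ∀ b x, Conflict a b → (b ≤ x ↔ i b ≤ i x) := by
    refine fun b x hb => ⟨fun h => Set.ncard_le_ncard fun d hd => ⟨hd.1, hd.2.trans h⟩,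
      fun h => ?_⟩
    by_contra hbx
    refine absurd h (not_le.2 (Set.ncard_lt_ncard ⟨fun d hd => ⟨hd.1, ?_⟩, fun hss => ?_⟩))
    · exact (hchain d b hd.1 hb).resolve_right fun h' => hbx (h'.trans hd.2)
    · exact hbx (hss (show b ∈ {d | Conflict a d ∧ d ≤ b} from ⟨hb, le_rfl⟩)).2
  have haa : ¬ Conflict a a := fun h => h.1 le_rfl
  have hmax : ∀ x ∈ A, x ≠ a → ¬ Conflict a x → ∀ y ∈ A, ¬ x < y := by
    intro x hx hxa hax
    refine (hA x hx).resolve_left ?_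
    rintro ⟨y, hxy⟩
    rcases hstar x y hxy with rfl | rfl
    · exact hxa rfl
    · exact hax hxy.symm
  refine EmbedsInGrid.of_lt
    (fun x => if x = a then 2 * n + 2 else if Conflict a x then 2 * i x else
      if a ≤ x then 2 * n + 3 else 2 * i x + 1)
    (fun x => if x = a then 0 else if Conflict a x then 2 * i x else
      if a ≤ x then 2 * i x + 1 else 2 * n + 3) fun x hx y hy => ?_
  clear_value i n
  have hix := hi x
  have hiy := hi y
  by_cases hxa : x = a
  · subst hxa
    by_cases hya : y = x
    · simp [hya]
    by_cases hcy : Conflict x y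
    · have : ¬ x < y := fun h => hcy.1 h.le
      simp only [this, hya, hcy, if_true, if_false, false_iff]
      omega
    by_cases hxy : x ≤ y
    · have : x < y := lt_of_le_of_ne hxy (Ne.symm hya)
      simp only [this, hya, hcy, hxy, if_true, if_false, true_iff]
      omega
    · have : ¬ x < y := fun h => hxy h.le
      simp only [this, hya, hcy, hxy, if_true, if_false, false_iff]
      omega
  by_cases hcx : Conflict a x
  · have hlt : x < y ↔ x ≤ y ∧ ¬ y ≤ x := lt_iff_le_not_ge
    have hxy := hle x y hcx
    by_cases hya : y = a
    · subst hya
      have : ¬ x < y := fun h => hcx.2.1 h.le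
      simp only [this, hxa, hcx, if_true, if_false, false_iff]
      omega
    by_cases hcy : Conflict a y
    · have hyx := hle y x hcy
      simp only [hya, hxa, hcx, hcy, if_true, if_false]
      rw [hlt, hxy, hyx]
      omega
    · have hne : x ≠ y := by
        rintro rfl
        exact hcy hcx
      rw [lt_iff_le_and_ne, hxy]
      by_cases hay : a ≤ y <;>
        simp only [hne, hya, hxa, hcx, hcy, hay, if_true, if_false, ne_eq, not_false_eq_true,
          and_true] <;> omega
  · have := hmax x hx hxa hcx y hy
    simp only [this, hxa, hcx, if_false, false_iff]
    split_ifs <;> omega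

set_option maxHeartbeats 400000 in
/-- The case where the center `a` has exactly two partners `b` and `d`, and these have no common
upper bound. The elements `b`, `a`, `d` are drawn from left to right on an antidiagonal; above them,
the maximal elements above `b` only, `b` and `a`, `a` only, `a` and `d`, `d` only follow each other,
and those above none of the three are placed at the far left. -/
theorem EmbedsInGrid.of_two {A : Set S} {a b d : S}
    (hstar : ∀ x y, Conflict x y → x = a ∨ y = a) (hab : Conflict a b) (had : Conflict a d)
    (hbd : ∀ u, b ≤ u → ¬ d ≤ u) (htwo : ∀ x, Conflict a x → x = b ∨ x = d)
    (hA : ∀ x ∈ A, (∃ y, Conflict x y) ∨ ∀ y ∈ A, ¬ x < y) : EmbedsInGrid A := by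
  classical
  have hmax : ∀ x ∈ A, x ≠ a → x ≠ b → x ≠ d → ∀ y ∈ A, ¬ x < y := by
    intro x hx hxa hxb hxd
    refine (hA x hx).resolve_left ?_
    rintro ⟨y, hxy⟩
    rcases hstar x y hxy with rfl | rfl
    · exact hxa rfl
    · exact (htwo x hxy.symm).elim hxb hxd
  obtain ⟨hab1, hab2, -⟩ := hab
  obtain ⟨had1, had2, -⟩ := had
  have hdb := hbd b le_rfl
  have hbd' : ¬ b ≤ d := fun h => hbd d h le_rfl
  refine EmbedsInGrid.of_lt
    (fun x => if x = a then 11 else if x = b then 1 else if x = d then 21 else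
      if a ≤ x then (if d ≤ x then 100 else 12) else
        if d ≤ x then 100 else if b ≤ x then 2 else 0)
    (fun x => if x = a then 11 else if x = b then 21 else if x = d then 1 else
      if a ≤ x then (if b ≤ x then 100 else 12) else
        if b ≤ x then 100 else if d ≤ x then 2 else 100) fun x hx y hy => ?_
  have hy' := hbd y
  have hne_ab : a ≠ b := fun h => hab1 h.le
  have hne_ad : a ≠ d := fun h => had1 h.le
  have hne_bd : b ≠ d := fun h => hbd' h.le
  by_cases hx' : x = a ∨ x = b ∨ x = d
  · have hlt : x < y ↔ x ≤ y ∧ x ≠ y := lt_iff_le_and_ne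
    rw [hlt]
    have hne := And.intro hne_ab.symm (And.intro hne_ad.symm hne_bd.symm)
    by_cases hya : y = a
    · rcases hx' with h | h | h <;> simp [*]
    by_cases hyb : y = b
    · rcases hx' with h | h | h <;> simp [*]
    by_cases hyd : y = d
    · rcases hx' with h | h | h <;> simp [*]
    have hya' : a ≠ y := Ne.symm hya
    have hyb' : b ≠ y := Ne.symm hyb
    have hyd' : d ≠ y := Ne.symm hyd
    by_cases h1 : a ≤ y <;> by_cases h2 : b ≤ y <;> by_cases h3 : d ≤ y
    all_goals first | exact absurd h3 (hy' h2) | rcases hx' with h | h | h <;> simp [*]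
  push Not at hx'
  obtain ⟨hxa, hxb, hxd⟩ := hx'
  have := hmax x hx hxa hxb hxd y hy
  simp only [this, hxa, hxb, hxd, if_false, false_iff]
  by_cases h1 : a ≤ x <;> by_cases h2 : b ≤ x <;> by_cases h3 : d ≤ x
  all_goals first | exact absurd h3 (hbd x h2) | simp only [h1, h2, h3, if_true, if_false]
  all_goals (split_ifs <;> first | omega | exact absurd ‹d ≤ y› (hy' ‹b ≤ y›))

/-- Induction on a subset `A` of the semilattice. An element in no conflict that is not maximal in `A`
allows the elements above it to be split off; otherwise only the elements in conflict lie below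
other elements of `A`, and the star of conflicts gives explicit coordinates. -/
theorem HasManyCongruences.embedsInGrid (H : HasManyCongruences S) :
    EmbedsInGrid (Set.univ : Set S) := by
  classical
  have := Fintype.ofFinite S
  rcases isEmpty_or_nonempty S with hS | hS
  · exact ⟨fun _ => 0, fun _ => 0, fun x => hS.elim x⟩
  obtain ⟨a, hstar⟩ := H.exists_center
  suffices h : ∀ A : Finset S, EmbedsInGrid (A : Set S) by simpa using h Finset.univ
  intro A
  induction A using Finset.strongInduction with
  | H A ih =>
    by_cases hy : ∃ y ∈ A, (∀ z, ¬ Conflict y z) ∧ ∃ m ∈ A, y < m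
    · obtain ⟨y, hyA, hyc, m, hmA, hym⟩ := hy
      refine EmbedsInGrid.of_above (y := y) hyA (fun x _ u _ hyu hxu => ?_) ?_ ?_
      · by_contra! h
        refine hyc x ⟨fun h' => h.2 (lt_of_le_of_ne h' ?_), h.1, u, hyu.le, hxu⟩
        rintro rfl
        exact h.1 le_rfl
      · have := ih (A.filter fun x => y < x) (Finset.filter_ssubset.2 ⟨y, hyA, lt_irrefl y⟩)
        simpa using this
      · have := ih (A.filter fun x => ¬ y < x) (Finset.filter_ssubset.2 ⟨m, hmA, not_not.2 hym⟩)
        simpa using this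
    · have hA : ∀ x ∈ (A : Set S), (∃ y, Conflict x y) ∨ ∀ y ∈ (A : Set S), ¬ x < y := by
        intro x hx
        by_contra! h
        exact hy ⟨x, hx, h⟩
      by_cases hchain : ∀ b d, Conflict a b → Conflict a d → b ≤ d ∨ d ≤ b
      · exact EmbedsInGrid.of_chain hstar hchain hA
      · push Not at hchain
        obtain ⟨b, d, hab, had, hbd, hdb⟩ := hchain
        have hub : ∀ u, b ≤ u → ¬ d ≤ u := by
          intro u hbu hdu
          rcases hstar b d ⟨hbd, hdb, u, hbu, hdu⟩ with rfl | rfl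
          · exact hab.1 le_rfl
          · exact had.1 le_rfl
        exact EmbedsInGrid.of_two hstar hab had hub (fun x hx => H.eq_of_conflict hab had hub hx) hA

end Embedding

/-! ### Dominance drawings -/

/-- Along a segment on which `x.1` and `x.2 - x.1` increase, both stay between their values at the
ends. -/
theorem mem_segment_bounds {p q x : ℝ × ℝ} (h1 : p.1 ≤ q.1) (h2 : p.2 - p.1 ≤ q.2 - q.1)
    (hx : x ∈ segment ℝ p q) :
    (p.1 ≤ x.1 ∧ x.1 ≤ q.1) ∧ p.2 - p.1 ≤ x.2 - x.1 ∧ x.2 - x.1 ≤ q.2 - q.1 := by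
  obtain ⟨s, t, hs, ht, hst, rfl⟩ := hx
  obtain rfl : s = 1 - t := by linarith
  simp only [Prod.fst_add, Prod.snd_add, Prod.smul_fst, Prod.smul_snd, smul_eq_mul]
  refine ⟨⟨?_, ?_⟩, ?_, ?_⟩ <;> nlinarith

/-- If two segments from `p` meet outside `p`, then the end of one of them lies on the other. -/
theorem mem_segment_of_mem_segments {p q r x : ℝ × ℝ} (hq : x ∈ segment ℝ p q)
    (hr : x ∈ segment ℝ p r) (hx : x ≠ p) : r ∈ segment ℝ p q ∨ q ∈ segment ℝ p r := by
  have key : ∀ (q r : ℝ × ℝ) (s t : ℝ), 0 < s → s ≤ t → p + s • (q - p) = p + t • (r - p) →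
      r ∈ segment ℝ p q := by
    intro q r s t hs hst h
    rw [segment_eq_image']
    have ht : 0 < t := hs.trans_le hst
    refine ⟨t⁻¹ * s, ⟨by positivity, by rw [inv_mul_le_one₀ ht]; exact hst⟩, ?_⟩
    have h' := add_left_cancel h
    simp only [mul_smul, h', inv_smul_smul₀ ht.ne']
    abel
  rw [segment_eq_image'] at hq hr
  obtain ⟨s, ⟨hs, -⟩, rfl⟩ := hq
  obtain ⟨t, ⟨ht, -⟩, hst⟩ := hr
  simp only at hst hx
  have hs' : 0 < s := hs.lt_of_ne (by rintro rfl; simp at hx)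
  have ht' : 0 < t := ht.lt_of_ne (by rintro rfl; rw [← hst] at hx; simp at hx)
  rcases le_total s t with h | h
  · exact Or.inl (key q r s t hs' h hst.symm)
  · exact Or.inr (key r q t s ht' h hst)

/-- The dominance drawing of a finite meet semilattice of order dimension at most two is planar.
If the edges `a ⋖ b` and `c ⋖ d` have a common point, then `a ≤ d` and `c ≤ b`, so that `b ⊓ d` lies
above `a` and `c` and the edges share a vertex. -/
theorem EmbedsInGrid.isPlanarPoset {S : Type*} [SemilatticeInf S]
    (h : EmbedsInGrid (Set.univ : Set S)) : IsPlanarPoset S := by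
  obtain ⟨f, g, hfg⟩ := h
  have hle : ∀ x y, x ≤ y ↔ (f x : ℝ) ≤ f y ∧ (g x : ℝ) ≤ g y := fun x y => by
    rw [hfg x trivial y trivial, Nat.cast_le, Nat.cast_le]
  -- A shear of the coordinates `(f, g)` under which the second coordinate is increasing.
  let pos : S → ℝ × ℝ := fun x => (f x, f x + g x)
  have hpos : ∀ x, (pos x).1 = f x ∧ (pos x).2 - (pos x).1 = g x := fun x =>
    ⟨rfl, add_sub_cancel_left _ _⟩
  have hinj : Function.Injective pos := by
    intro x y hxy
    have h1 := hpos x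
    rw [hxy, (hpos y).1, (hpos y).2] at h1
    exact le_antisymm ((hle x y).2 ⟨h1.1.ge, h1.2.ge⟩) ((hle y x).2 ⟨h1.1.le, h1.2.le⟩)
  have hbounds : ∀ {a b : S} {x : ℝ × ℝ}, a ≤ b → x ∈ segment ℝ (pos a) (pos b) →
      ((f a : ℝ) ≤ x.1 ∧ x.1 ≤ f b) ∧ (g a : ℝ) ≤ x.2 - x.1 ∧ x.2 - x.1 ≤ g b := by
    intro a b x hab hx
    have h' := (hle a b).1 hab
    have := mem_segment_bounds (by rw [(hpos a).1, (hpos b).1]; exact h'.1)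
      (by rw [(hpos a).2, (hpos b).2]; exact h'.2) hx
    rwa [(hpos a).1, (hpos b).1, (hpos a).2, (hpos b).2] at this
  have hmem : ∀ {a b c : S}, a ⋖ b → pos c ∈ segment ℝ (pos a) (pos b) → c = a ∨ c = b := by
    intro a b c hab hc
    obtain ⟨⟨h1, h2⟩, h3, h4⟩ := hbounds hab.le hc
    rw [(hpos c).2] at h3 h4
    exact hab.eq_or_eq ((hle a c).2 ⟨h1, h3⟩) ((hle c b).2 ⟨h2, h4⟩)
  have hheight : ∀ {a b : S}, a ⋖ b → (pos a).2 < (pos b).2 := by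
    intro a b hab
    have h1 := (hle a b).1 hab.le
    have h2 : ¬ b ≤ a := hab.lt.not_ge
    rw [hle] at h2
    by_contra! hcon
    have h3 : (f b : ℝ) + g b ≤ f a + g a := hcon
    exact h2 ⟨by linarith, by linarith⟩
  refine ⟨⟨pos, hinj, hheight, hmem⟩, ?_⟩
  intro a b c d hab hcd hne x hx hx'
  change (x = pos a ∨ x = pos b) ∧ (x = pos c ∨ x = pos d)
  change x ∈ segment ℝ (pos a) (pos b) at hx
  change x ∈ segment ℝ (pos c) (pos d) at hx'
  obtain ⟨⟨h1, h2⟩, h3, h4⟩ := hbounds hab.le hx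
  obtain ⟨⟨h1', h2'⟩, h3', h4'⟩ := hbounds hcd.le hx'
  have had : a ≤ d := (hle a d).2 ⟨h1.trans h2', h3.trans h4'⟩
  have hcb : c ≤ b := (hle c b).2 ⟨h1'.trans h2, h3'.trans h4⟩
  have hpoint : ∀ v : S, (f v : ℝ) ≤ x.1 → x.1 ≤ f v → (g v : ℝ) ≤ x.2 - x.1 →
      x.2 - x.1 ≤ g v → x = pos v := by
    intro v e1 e2 e3 e4
    have e5 := (hpos v).1
    have e6 := (hpos v).2
    exact Prod.ext (by linarith) (by linarith)
  rcases hab.eq_or_eq (le_inf hab.le had) inf_le_left with hm | hm <;>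
    rcases hcd.eq_or_eq (le_inf hcb hcd.le) inf_le_right with hm' | hm'
  · obtain rfl : a = c := hm.symm.trans hm'
    by_cases hxa : x = pos a
    · exact ⟨Or.inl hxa, Or.inl hxa⟩
    have hbd : b ≠ d := by
      rintro rfl
      exact hne rfl
    exfalso
    rcases mem_segment_of_mem_segments hx hx' hxa with h | h
    · exact (hmem hab h).elim hcd.ne' hbd.symm
    · exact (hmem hcd h).elim hab.ne' hbd
  · obtain rfl : a = d := hm.symm.trans hm'
    have := hpoint a h1 h2' h3 h4'
    exact ⟨Or.inl this, Or.inr this⟩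
  · obtain rfl : b = c := hm.symm.trans hm'
    have := hpoint b h1' h2 h3' h4
    exact ⟨Or.inr this, Or.inl this⟩
  · obtain rfl : b = d := hm.symm.trans hm'
    by_cases hxb : x = pos b
    · exact ⟨Or.inr hxb, Or.inr hxb⟩
    have hac : a ≠ c := by
      rintro rfl
      exact hne rfl
    exfalso
    rw [segment_symm] at hx hx'
    rcases mem_segment_of_mem_segments hx hx' hxb with h | h
    · rw [segment_symm] at h
      exact (hmem hab h).elim hac.symm hcd.ne
    · rw [segment_symm] at h
      exact (hmem hcd h).elim hac hab.ne

theorem corollary2p5 {S : Type*} [SemilatticeInf S] [Finite S] (n : ℕ) (hn : Nat.card S = n)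
    (hcon : (25 : ℝ) * (2 : ℝ) ^ ((n : ℤ) - 6) ≤ (Nat.card (MeetCongruence S) : ℝ)) :
    IsPlanarPoset S := by
  have H : HasManyCongruences S := by
    rw [zpow_sub₀ (by norm_num), zpow_natCast] at hcon
    have : (25 * 2 ^ n : ℝ) ≤ 64 * Nat.card (MeetCongruence S) := by
      norm_num at hcon
      linarith
    unfold HasManyCongruences
    rw [hn]
    exact_mod_cast this
  exact H.embedsInGrid.isPlanarPoset
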